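/- **Definitions.** Let $\kappa$ be a regular (in particular infinite) cardinal. A *record* of length $\alpha$ is a sequence $(r(\beta))_{\beta<\alpha}$ of zeros and ones such that for every limit ordinal $\lambda\le\alpha$ there is $\gamma<\lambda$ with $r(\beta)=0$ whenever $\gamma\le\beta<\lambda$; the *$\lambda$-parity* $\lambda\text{-par}(r)$ is the parity of the least such $\gamma$, where an ordinal $\hat\lambda+n$ ($\hat\lambda$ zero or a limit ordinal, $n\in\mathbb N$) has the parity of $n$. Let $W^\alpha$ be the set of triples $w=(w_0,w_a,w_b)$ with $w_0\in\{h,t\}$ and $w_a,w_b$ records of length $\alpha$ (so $W^0=\{h,t\}$), and for $\beta\le\alpha$ let $w\upharpoonright\beta\in W^\beta$ be obtained by restricting both records to length $\beta$. For $\{i,j\}=\{a,b\}$ and $w\in W^\kappa$ let $P_i(w)$ be the set of all $v\in W^\kappa$ with $v_i=w_i$ such that: $w_i(0)=1$ implies $v_0=w_0$; for every $\beta<\kappa$, $w_i(\beta+1)=1$ implies $v_j(\beta)=w_j(\beta)$; and for every limit ordinal $\lambda<\kappa$, $w_i(\lambda)=1$ implies $\lambda\text{-par}(v_j)=\lambda\text{-par}(w_j)$.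 A *$*$-type space* on a set $S$ (states of nature) for a player set $I$ is $\langle M,(T_i)_{i\in I},\theta\rangle$ with $M\ne\emptyset$, $\theta:M\to S$, and, for each $m\in M$ and $i\in I$, $T_i(m)$ a finitely additive probability measure on all subsets of $M$ with $T_i(m)(\{m' : T_i(m')=T_i(m)\})=1$. For a cardinal $\kappa$, the *$\kappa$-expressions* are built from the subsets $E\subseteq S$ (depth $0$) by negation (same depth), by $B_i^p$ with $i\in I$, $p\in[0,1]$ (depth increases by $1$), and by conjunctions of nonempty families of fewer than $\kappa$ expressions (depth is the supremum of the depths). In a $*$-type space $E$ is true at $m$ iff $\theta(m)\in E$; $B_i^p(\varphi)$ is true at $m$ iff $T_i(m)$ gives the set of states where $\varphi$ is true probability at least $p$; negation and conjunction have their usual meaning. The *$\kappa$-description* of $m$ is the set of $\kappa$-expressions true at $m$. Consider pairs $(T_a,T_b)$ of functions from $W^\kappa$ to the finitely additive probability measures on all subsets of $W^\kappa$ such that, for $\{i,j\}=\{a,b\}$ and all $u,w\in W^\kappa$: - (a) $T_i(u)=T_i(w)$ if $u\in P_i(w)$; - (b) $T_i(w)(P_i(w))=1$; - (c) $T_i(w)(\{v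 : v_0=w_0\})$ is $1$ if $w_i(0)=1$ and $\frac12$ if $w_i(0)=0$; - (d) for $\beta<\kappa$, $T_i(w)(\{v : v_j(\beta)=w_j(\beta)\})$ is $1$ if $w_i(\beta+1)=1$ and $\frac12$ if $w_i(\beta+1)=0$; - (e) for limit ordinals $\lambda<\kappa$, $T_i(w)(\{v : \lambda\text{-par}(v_j)=\lambda\text{-par}(w_j)\})$ is $1$ if $w_i(\lambda)=1$ and $\frac12$ if $w_i(\lambda)=0$; - (f) if $\beta<\alpha<\kappa$, $E\subseteq W^\beta$ and $u\upharpoonright\alpha=w\upharpoonright\alpha$, then $T_i(u)(\{v : v\upharpoonright\beta\in E\})=T_i(w)(\{v : v\upharpoonright\beta\in E\})$. With $\theta(w)=w_0$, every such pair makes $W^\kappa$ a $*$-type space on $\{h,t\}$ for the players $\{a,b\}$. **Theorem 3.** (i) For every regular cardinal $\kappa$ such pairs $(T_a,T_b)$ exist, and for each of them the $*$-type space $\langle W^\kappa,(T_i)_{i\in\{a,b\}},\theta\rangle$ has the following property: for every ordinal $\alpha<\kappa$ there are $u,w\in W^\kappa$ such that every $\kappa$-expression of depth $\le\alpha$ is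 true either at both $u$ and $w$ or at neither, and some $\kappa$-expression $\psi$ of depth exactly $\alpha+1$ is true at $u$ while $\neg\psi$ is true at $w$. (ii) Consequently, if $|I|\ge2$ and $|S|\ge2$, there is no cardinal $\hat\kappa$ such that for all regular cardinals $\kappa>\hat\kappa$ the $\hat\kappa$-description of a state in a $*$-type space on $S$ for player set $I$ determines its $\kappa$-description (that is, such that any two states of the same $*$-type space with equal $\hat\kappa$-descriptions have equal $\kappa$-descriptions). -/

import Mathlib

open Cardinal Ordinal

universe u v w

namespace Belief

/-! ### Finitely additive beliefs and type spaces with all subsets measurable -/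

/-- A finitely additive probability measure on `(M, Pow M)`. -/
@[ext]
structure FinAddProb (M : Type u) where
  /-- the value of the measure on a subset of `M` -/
  prob : Set M → ℝ
  nonneg : ∀ E, 0 ≤ prob E
  add_of_disjoint : ∀ E F, Disjoint E F → prob (E ∪ F) = prob E + prob F
  prob_univ : prob Set.univ = 1

/-- A `*`-type space with set of states of the world `M`, on the set `S` of states of nature, for the
player set `I`: every subset of `M` and of `S` is measurable. -/
structure StarTypeSpace (I : Type v) (S : Type w) (M : Type u) where
  nonempty : Nonempty M
  /-- the type `T i m` of player `i` in the state `m` -/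
  T : I → M → FinAddProb M
  /-- each player is certain of his own type -/
  introspection : ∀ i m, (T i m).prob {m' | T i m' = T i m} = 1
  /-- the state of nature that corresponds to a state of the world -/
  θ : M → S

/-- The event that player `i` assigns probability at least `p` to `E`. -/
def StarTypeSpace.believes {I : Type v} {S : Type w} {M : Type u} (X : StarTypeSpace I S M)
    (i : I) (p : ℝ) (E : Set M) : Set M :=
  {m | p ≤ (X.T i m).prob E}

/-! ### Expressions -/

/-- The `κ`-expressions for the player set `I` and the states of nature `S` (with all subsets of `S`
measurable). A conjunction is taken over a nonempty family of fewer than `κ` expressions. -/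
inductive KExpr (κ : Cardinal.{u}) (I : Type v) (S : Type w) : Type (max (u + 1) v w)
  | nature (E : Set S) : KExpr κ I S
  | neg (φ : KExpr κ I S) : KExpr κ I S
  | belief (i : I) (p : unitInterval) (φ : KExpr κ I S) : KExpr κ I S
  | conj (ι : Type u) (hne : Nonempty ι) (hcard : #ι < κ) (φ : ι → KExpr κ I S) : KExpr κ I S

/-- The depth of an expression. -/
noncomputable def KExpr.depth {κ : Cardinal.{u}} {I : Type v} {S : Type w} :
    KExpr κ I S → Ordinal.{u}
  | .nature _ => 0
  | .neg φ => φ.depth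
  | .belief _ _ φ => φ.depth + 1
  | .conj _ _ _ φ => ⨆ k, (φ k).depth

/-- The event described by an expression in a type space. -/
def StarTypeSpace.event {I : Type v} {S : Type w} {M : Type*} (X : StarTypeSpace I S M)
    {κ : Cardinal.{u}} : KExpr κ I S → Set M
  | .nature E => X.θ ⁻¹' E
  | .neg φ => (X.event φ)ᶜ
  | .belief i p φ => X.believes i p (X.event φ)
  | .conj _ _ _ φ => ⋂ k, X.event (φ k)

/-- The `κ`-description of a state of the world: the set of the `κ`-expressions true in it. -/
def StarTypeSpace.description {I : Type v} {S : Type w} {M : Type*} (X : StarTypeSpace I S M)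
    (κ : Cardinal.{u}) (m : M) : Set (KExpr κ I S) :=
  {φ | m ∈ X.event φ}

/-! ### Records -/

/-- A record of length `α`: a sequence of zeros (`false`) and ones (`true`) indexed by the ordinals
below `α` that is eventually zero below every limit ordinal `l ≤ α`. -/
@[ext]
structure Record (α : Ordinal.{u}) where
  /-- the entries of the record -/
  val : Set.Iio α → Bool
  eventually_zero : ∀ l : Ordinal.{u}, Order.IsSuccLimit l → l ≤ α →
    ∃ γ < l, ∀ β : Set.Iio α, γ ≤ β.1 → β.1 < l → val β = false

/-- The entry of a record at the ordinal `β < α`. -/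
def Record.entry {α : Ordinal.{u}} (r : Record α) (β : Ordinal.{u}) (h : β < α) : Bool :=
  r.val ⟨β, h⟩

/-- The initial segment of length `β` of a record. -/
def Record.restrict {α : Ordinal.{u}} (r : Record α) (β : Ordinal.{u}) (h : β ≤ α) : Record β where
  val ξ := r.val ⟨ξ.1, lt_of_lt_of_le ξ.2 h⟩
  eventually_zero l hl hlβ := by
    obtain ⟨γ, hγ, hz⟩ := r.eventually_zero l hl (hlβ.trans h)
    exact ⟨γ, hγ, fun ξ h1 h2 => hz ⟨ξ.1, lt_of_lt_of_le ξ.2 h⟩ h1 h2⟩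

/-- An ordinal `l + n`, with `l` zero or a limit ordinal and `n` a natural number, is even if `n` is
even; it is odd otherwise. -/
def OrdEven (γ : Ordinal.{u}) : Prop :=
  ∃ (l : Ordinal.{u}) (n : ℕ), (l = 0 ∨ Order.IsSuccLimit l) ∧ γ = l + n ∧ Even n

/-- For a limit ordinal `l ≤ α`, the least ordinal from which on the record vanishes below `l`. -/
noncomputable def Record.lastZero {α : Ordinal.{u}} (r : Record α) (l : Ordinal.{u}) :
    Ordinal.{u} :=
  sInf {γ | γ < l ∧ ∀ β : Set.Iio α, γ ≤ β.1 → β.1 < l → r.val β = false}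

/-- The `l`-parity of a record is even. -/
def Record.ParEven {α : Ordinal.{u}} (r : Record α) (l : Ordinal.{u}) : Prop :=
  OrdEven (r.lastZero l)

/-! ### The spaces of states of the world -/

/-- The two states of nature. -/
inductive Coin : Type
  | h
  | t

/-- The two players. -/
inductive Player : Type
  | a
  | b

/-- The other player. -/
def Player.other : Player → Player
  | .a => .b
  | .b => .a

/-- The space `W^α`: a state of nature together with a record of length `α` for each player. For
`α = 0` the records are empty and this is the set of states of nature. -/
@[ext]
structure World (α : Ordinal.{u}) where
  /-- the state of nature -/
  nat : Coin
  /-- the record of each player -/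
  rcd : Player → Record α

/-- The projection `W^α → W^β` for `β ≤ α`. -/
def World.restrict {α : Ordinal.{u}} (x : World α) (β : Ordinal.{u}) (h : β ≤ α) : World β where
  nat := x.nat
  rcd i := (x.rcd i).restrict β h

/-- The element of the partition of player `i` that contains the state `x`. -/
def World.cell {α : Ordinal.{u}} (i : Player) (x : World α) : Set (World α) :=
  {y | y.rcd i = x.rcd i ∧
    (∀ h : 0 < α, (x.rcd i).entry 0 h = true → y.nat = x.nat) ∧
    (∀ (β : Ordinal.{u}) (hβ : β < α) (h : β + 1 < α), (x.rcd i).entry (β + 1) h = true →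
      (y.rcd i.other).entry β hβ = (x.rcd i.other).entry β hβ) ∧
    (∀ (l : Ordinal.{u}) (h : l < α), Order.IsSuccLimit l → (x.rcd i).entry l h = true →
      ((y.rcd i.other).ParEven l ↔ (x.rcd i.other).ParEven l))}

/-- The requirements on the beliefs `T` of the two players over `W^κ`. -/
structure IsSoberDrunk (κ : Cardinal.{u})
    (T : Player → World κ.ord → FinAddProb (World κ.ord)) : Prop where
  /-- a player has the same beliefs in all states that he cannot distinguish -/
  eq_of_mem_cell : ∀ i x y, y ∈ World.cell i x → T i y = T i x
  /-- a player is certain of his information -/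
  prob_cell : ∀ i x, (T i x).prob (World.cell i x) = 1
  /-- beliefs about nature -/
  prob_nat : ∀ i x (h : 0 < κ.ord), (T i x).prob {y | y.nat = x.nat} =
    if (x.rcd i).entry 0 h = true then 1 else 1 / 2
  /-- beliefs about the entries of the record of the other player -/
  prob_entry : ∀ i x (β : Ordinal.{u}) (hβ : β < κ.ord) (h : β + 1 < κ.ord),
    (T i x).prob {y | (y.rcd i.other).entry β hβ = (x.rcd i.other).entry β hβ} =
      if (x.rcd i).entry (β + 1) h = true then 1 else 1 / 2
  /-- beliefs about the parities of the record of the other player -/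
  prob_parity : ∀ i x (l : Ordinal.{u}) (h : l < κ.ord), Order.IsSuccLimit l →
    (T i x).prob {y | (y.rcd i.other).ParEven l ↔ (x.rcd i.other).ParEven l} =
      if (x.rcd i).entry l h = true then 1 else 1 / 2
  /-- the entries below `α` determine the beliefs about the entries below `β`, for `β < α` -/
  prob_level : ∀ i (x y : World κ.ord) (α β : Ordinal.{u}) (hα : α < κ.ord) (hβ : β < α),
    x.restrict α hα.le = y.restrict α hα.le → ∀ E : Set (World β),
      (T i x).prob {z | z.restrict β (hβ.trans hα).le ∈ E} =
        (T i y).prob {z | z.restrict β (hβ.trans hα).le ∈ E}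

/-- The `*`-type space on `{h, t}` for the players `a, b` whose set of states of the world is `W^κ`
and whose beliefs are given by `T`. -/
def soberDrunkSpace {κ : Cardinal.{u}} (T : Player → World κ.ord → FinAddProb (World κ.ord))
    (hT : IsSoberDrunk κ T) : StarTypeSpace Player Coin (World κ.ord) where
  nonempty := ⟨⟨Coin.h, fun _ => ⟨fun _ => false, fun l hl _ =>
    ⟨0, hl.bot_lt, fun _ _ _ => rfl⟩⟩⟩⟩
  T := T
  introspection i x := by
    have mono : ∀ E F : Set (World κ.ord), E ⊆ F → (T i x).prob E ≤ (T i x).prob F := by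
      intro E F hEF
      have h := (T i x).add_of_disjoint E (F \ E) Set.disjoint_sdiff_right
      rw [Set.union_sdiff_cancel hEF] at h
      linarith [(T i x).nonneg (F \ E)]
    refine le_antisymm ?_ ?_
    · rw [← (T i x).prob_univ]
      exact mono _ _ (Set.subset_univ _)
    · rw [← hT.prob_cell i x]
      exact mono _ _ fun y hy => hT.eq_of_mem_cell i x y hy
  θ x := x.nat

end Belief

open Belief

namespace Belief

/-! ### Ordinals and parity -/

@[elab_as_elim]
theorem ordinal_cases {motive : Ordinal.{u} → Prop} (ξ : Ordinal.{u}) (zero : motive 0)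
    (succ : ∀ β, motive (β + 1)) (limit : ∀ l, Order.IsSuccLimit l → motive l) : motive ξ := by
  rcases zero_or_succ_or_isSuccLimit ξ with h | ⟨β, h⟩ | h
  · exact h ▸ zero
  · rw [← h, Order.succ_eq_add_one]
    exact succ β
  · exact limit ξ h

theorem not_isSuccLimit_add_one (β : Ordinal.{u}) : ¬ Order.IsSuccLimit (β + 1) := by
  rw [← Order.succ_eq_add_one]
  exact Order.not_isSuccLimit_succ β

theorem isSuccLimit_add_one_lt {l β : Ordinal.{u}} (hl : Order.IsSuccLimit l) (h : β < l) :
    β + 1 < l := by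
  rw [← Order.succ_eq_add_one]
  exact hl.succ_lt h

theorem add_natCast_lt_limit {l β : Ordinal.{u}} (hl : Order.IsSuccLimit l) (h : β < l) (n : ℕ) :
    β + n < l := by
  induction n with
  | zero => simpa using h
  | succ n ih =>
    have := isSuccLimit_add_one_lt hl ih
    rwa [add_assoc, ← Nat.cast_succ] at this

theorem exists_limit_add_nat (ξ : Ordinal.{u}) :
    ∃ (l : Ordinal.{u}) (n : ℕ), (l = 0 ∨ Order.IsSuccLimit l) ∧ ξ = l + n := by
  induction ξ using WellFoundedLT.induction with
  | ind ξ ih =>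
    revert ih
    refine ordinal_cases ξ ?_ ?_ ?_
    · exact fun _ => ⟨0, 0, Or.inl rfl, by simp⟩
    · intro β ih
      obtain ⟨l, n, hl, rfl⟩ := ih β (lt_add_one β)
      exact ⟨l, n + 1, hl, by rw [add_assoc, Nat.cast_succ]⟩
    · exact fun l hl _ => ⟨l, 0, Or.inr hl, by simp⟩

theorem limit_le_of_add_nat_eq {l l' : Ordinal.{u}} {n n' : ℕ}
    (hl' : l' = 0 ∨ Order.IsSuccLimit l') (h : l + n = l' + n') : l' ≤ l := by
  by_contra! hlt
  rcases hl' with rfl | hl'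
  · exact absurd hlt (not_lt.2 (zero_le))
  · have h1 := add_natCast_lt_limit hl' hlt n
    rw [h] at h1
    exact absurd h1 (not_lt.2 le_self_add)

theorem limit_add_nat_unique {l l' : Ordinal.{u}} {n n' : ℕ} (hl : l = 0 ∨ Order.IsSuccLimit l)
    (hl' : l' = 0 ∨ Order.IsSuccLimit l') (h : l + n = l' + n') : n = n' := by
  obtain rfl := le_antisymm (limit_le_of_add_nat_eq hl h.symm) (limit_le_of_add_nat_eq hl' h)
  exact_mod_cast add_left_cancel h

theorem ordEven_add_one (ξ : Ordinal.{u}) : OrdEven (ξ + 1) ↔ ¬ OrdEven ξ := by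
  obtain ⟨l, n, hl, rfl⟩ := exists_limit_add_nat ξ
  have key : ∀ m : ℕ, OrdEven (l + m) ↔ Even m := fun m =>
    ⟨fun ⟨l', m', hl', h, he⟩ => limit_add_nat_unique hl hl' h ▸ he, fun h => ⟨l, m, hl, rfl, h⟩⟩
  have h1 : l + (n : Ordinal.{u}) + 1 = l + ((n + 1 : ℕ) : Ordinal.{u}) := by
    rw [add_assoc, Nat.cast_succ]
  rw [h1, key, key, Nat.even_add_one]

/-! ### Records as finite sets of ordinals -/

/-- The set of ordinals at which a record is `1`. -/
def Record.support {α : Ordinal.{u}} (r : Record α) : Set Ordinal.{u} :=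
  {ξ | ∃ h : ξ < α, r.entry ξ h = true}

theorem Record.finite_support {α : Ordinal.{u}} (r : Record α) : r.support.Finite := by
  have key : ∀ l ≤ α, (r.support ∩ Set.Iio l).Finite := by
    intro l
    induction l using WellFoundedLT.induction with
    | ind l ih =>
      revert ih
      refine ordinal_cases l ?_ ?_ ?_
      · intro _ _
        simp
      · intro β ih hβ
        refine ((ih β (lt_add_one β) ((le_self_add).trans hβ)).insert β).subset ?_
        rintro ξ ⟨h1, h2⟩
        rcases (Order.lt_add_one_iff.1 (Set.mem_Iio.1 h2)).eq_or_lt with h | h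
        · exact Or.inl h
        · exact Or.inr ⟨h1, h⟩
      · intro l hl ih hlα
        obtain ⟨γ, hγ, hz⟩ := r.eventually_zero l hl hlα
        refine (ih γ hγ (hγ.le.trans hlα)).subset ?_
        rintro ξ ⟨⟨h1, h2⟩, h3⟩
        refine ⟨⟨h1, h2⟩, ?_⟩
        by_contra h4
        have := hz ⟨ξ, h1⟩ (not_lt.1 h4) h3
        rw [Record.entry] at h2
        simp [this] at h2
  refine (key α le_rfl).subset fun ξ hξ => ⟨hξ, ?_⟩
  exact hξ.1

open Classical in
/-- The record that is `1` exactly at the elements of a finite set. -/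
noncomputable def Record.ofFinite (α : Ordinal.{u}) (s : Set Ordinal.{u}) (hs : s.Finite) :
    Record α where
  val ξ := decide (ξ.1 ∈ s)
  eventually_zero l hl _ := by
    have hfin : (s ∩ Set.Iio l).Finite := hs.subset Set.inter_subset_left
    refine ⟨hfin.toFinset.sup (fun ξ => ξ + 1), ?_, ?_⟩
    · rw [Finset.sup_lt_iff hl.bot_lt]
      intro ξ hξ
      exact isSuccLimit_add_one_lt hl ((hfin.mem_toFinset.1 hξ).2)
    · intro β h1 h2
      rw [decide_eq_false_iff_not]
      intro h3
      have := Finset.le_sup (f := fun ξ : Ordinal.{u} => ξ + 1) (hfin.mem_toFinset.2 ⟨h3, h2⟩)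
      exact absurd ((lt_add_one β.1).trans_le (this.trans h1)) (lt_irrefl _)

theorem Record.entry_ofFinite {α : Ordinal.{u}} {s : Set Ordinal.{u}} {hs : s.Finite}
    {ξ : Ordinal.{u}} (h : ξ < α) : (Record.ofFinite α s hs).entry ξ h = true ↔ ξ ∈ s := by
  simp [Record.entry, Record.ofFinite]

theorem Record.restrict_ofFinite_congr {α β : Ordinal.{u}} (h : β ≤ α) {s t : Set Ordinal.{u}}
    {hs : s.Finite} {ht : t.Finite} (hst : ∀ ξ < β, ξ ∈ s ↔ ξ ∈ t) :
    (Record.ofFinite α s hs).restrict β h = (Record.ofFinite α t ht).restrict β h := by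
  ext ξ
  simp [Record.restrict, Record.ofFinite, hst ξ.1 ξ.2]

theorem Record.entry_congr_of_restrict_eq {α γ : Ordinal.{u}} (h : γ ≤ α) {r s : Record α}
    (hrs : r.restrict γ h = s.restrict γ h) {ξ : Ordinal.{u}} (hξ : ξ < γ) :
    r.entry ξ (hξ.trans_le h) = s.entry ξ (hξ.trans_le h) :=
  congrFun (congrArg Record.val hrs) ⟨ξ, hξ⟩

theorem Record.lastZero_congr {α : Ordinal.{u}} {r s : Record α} {l : Ordinal.{u}}
    (h : ∀ (ξ : Ordinal.{u}) (hξ : ξ < α), ξ < l → r.entry ξ hξ = s.entry ξ hξ) :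
    r.lastZero l = s.lastZero l := by
  unfold Record.lastZero
  congr 1
  ext γ
  refine and_congr_right fun _ => forall_congr' fun β => ?_
  refine imp_congr_right fun _ => imp_congr_right fun h2 => ?_
  have := h β.1 β.2 h2
  simp only [Record.entry] at this
  rw [this]

theorem Record.lastZero_eq_add_one {α : Ordinal.{u}} {r : Record α} {l ξ : Ordinal.{u}}
    (hl : Order.IsSuccLimit l) (hξα : ξ < α) (hξ : ξ < l) (h1 : r.entry ξ hξα = true)
    (h0 : ∀ (β : Ordinal.{u}) (hβ : β < α), ξ < β → β < l → r.entry β hβ = false) :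
    r.lastZero l = ξ + 1 := by
  apply le_antisymm
  · refine csInf_le' ⟨isSuccLimit_add_one_lt hl hξ, fun β h2 h3 => ?_⟩
    exact h0 β.1 β.2 ((lt_add_one ξ).trans_le h2) h3
  · refine le_csInf ⟨ξ + 1, isSuccLimit_add_one_lt hl hξ, fun β h2 h3 => ?_⟩ ?_
    · exact h0 β.1 β.2 ((lt_add_one ξ).trans_le h2) h3
    · rintro γ ⟨_, h3⟩
      by_contra! h4
      have := h3 ⟨ξ, hξα⟩ (Order.lt_add_one_iff.1 h4) hξ
      rw [Record.entry] at h1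
      simp [h1] at this

/-! ### The facts about which a player may have information -/

/-- The fact about a state that player `i` knows if the entry `ξ` of his record is `1`: the state of
nature for `ξ = 0`, an entry of the other record for a successor, a parity of it for a limit. -/
def World.datum {α : Ordinal.{u}} (i : Player) (x : World α) (ξ : Ordinal.{u}) : Prop :=
  (ξ = 0 ∧ x.nat = Coin.h) ∨
    (∃ (β : Ordinal.{u}) (h : β < α), ξ = β + 1 ∧ (x.rcd i.other).entry β h = true) ∨
    (Order.IsSuccLimit ξ ∧ (x.rcd i.other).ParEven ξ)

theorem World.datum_zero {α : Ordinal.{u}} {i : Player} {x : World α} :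
    x.datum i 0 ↔ x.nat = Coin.h := by
  constructor
  · rintro (h | ⟨β, _, h, _⟩ | ⟨h, _⟩)
    · exact h.2
    · exact absurd ((lt_add_one β).trans_eq h.symm) (not_lt.2 zero_le)
    · exact absurd rfl h.ne_zero
  · exact fun h => Or.inl ⟨rfl, h⟩

theorem World.datum_add_one {α : Ordinal.{u}} {i : Player} {x : World α} {β : Ordinal.{u}}
    (hβ : β < α) : x.datum i (β + 1) ↔ (x.rcd i.other).entry β hβ = true := by
  constructor
  · rintro (h | ⟨γ, hγ, h, h'⟩ | ⟨h, _⟩)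
    · exact absurd h.1 (by simp)
    · obtain rfl : β = γ := by simpa using h
      exact h'
    · exact absurd h (not_isSuccLimit_add_one β)
  · exact fun h => Or.inr (Or.inl ⟨β, hβ, rfl, h⟩)

theorem World.datum_limit {α : Ordinal.{u}} {i : Player} {x : World α} {l : Ordinal.{u}}
    (hl : Order.IsSuccLimit l) : x.datum i l ↔ (x.rcd i.other).ParEven l := by
  constructor
  · rintro (h | ⟨γ, hγ, h, h'⟩ | ⟨_, h⟩)
    · exact absurd h.1 hl.ne_zero
    · exact absurd (h ▸ hl) (not_isSuccLimit_add_one γ)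
    · exact h
  · exact fun h => Or.inr (Or.inr ⟨hl, h⟩)

theorem Coin.eq_iff_h_iff (c d : Coin) : c = d ↔ (c = Coin.h ↔ d = Coin.h) := by
  cases c <;> cases d <;> simp

theorem World.nat_eq_iff {α : Ordinal.{u}} {i : Player} {x y : World α} :
    y.nat = x.nat ↔ (y.datum i 0 ↔ x.datum i 0) := by
  rw [World.datum_zero, World.datum_zero, ← Coin.eq_iff_h_iff]

theorem World.entry_eq_iff {α : Ordinal.{u}} {i : Player} {x y : World α} {β : Ordinal.{u}}
    (hβ : β < α) : (y.rcd i.other).entry β hβ = (x.rcd i.other).entry β hβ ↔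
      (y.datum i (β + 1) ↔ x.datum i (β + 1)) := by
  rw [World.datum_add_one hβ, World.datum_add_one hβ, ← Bool.eq_iff_iff]

theorem World.parEven_iff {α : Ordinal.{u}} {i : Player} {x y : World α} {l : Ordinal.{u}}
    (hl : Order.IsSuccLimit l) : ((y.rcd i.other).ParEven l ↔ (x.rcd i.other).ParEven l) ↔
      (y.datum i l ↔ x.datum i l) := by
  rw [World.datum_limit hl, World.datum_limit hl]

theorem World.mem_cell_iff {α : Ordinal.{u}} {i : Player} {x y : World α} :
    y ∈ World.cell i x ↔ y.rcd i = x.rcd i ∧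
      ∀ ξ ∈ (x.rcd i).support, (y.datum i ξ ↔ x.datum i ξ) := by
  refine and_congr_right fun _ => ⟨?_, ?_⟩
  · rintro ⟨h0, h1, h2⟩ ξ
    refine ordinal_cases ξ ?_ ?_ ?_
    · exact fun ⟨h, h'⟩ => World.nat_eq_iff.1 (h0 h h')
    · exact fun β ⟨h, h'⟩ =>
        (World.entry_eq_iff _).1 (h1 β ((lt_add_one β).trans h) h h')
    · exact fun l hl ⟨h, h'⟩ => (World.parEven_iff hl).1 (h2 l h hl h')
  · exact fun H => ⟨fun h h' => World.nat_eq_iff.2 (H 0 ⟨h, h'⟩),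
      fun β hβ h h' => (World.entry_eq_iff hβ).2 (H _ ⟨h, h'⟩),
      fun l h hl h' => (World.parEven_iff hl).2 (H l ⟨h, h'⟩)⟩

theorem World.datum_congr {α γ ξ : Ordinal.{u}} (h : γ ≤ α) {i : Player} {x y : World α}
    (hxy : x.restrict γ h = y.restrict γ h) (hξ : ξ ≤ γ) : x.datum i ξ ↔ y.datum i ξ := by
  have hr : (x.rcd i.other).restrict γ h = (y.rcd i.other).restrict γ h :=
    congrFun (congrArg World.rcd hxy) i.other
  revert hξ
  refine ordinal_cases ξ ?_ ?_ ?_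
  · intro _
    have hn : (x.restrict γ h).nat = (y.restrict γ h).nat := congrArg World.nat hxy
    rw [World.datum_zero, World.datum_zero, show x.nat = y.nat from hn]
  · intro β hβ
    have hβ' : β < γ := Order.add_one_le_iff.1 hβ
    rw [World.datum_add_one (hβ'.trans_le h), World.datum_add_one (hβ'.trans_le h),
      Record.entry_congr_of_restrict_eq h hr hβ']
  · intro l hl hlγ
    rw [World.datum_limit hl, World.datum_limit hl, Record.ParEven, Record.ParEven,
      Record.lastZero_congr fun ζ _ hζl =>
        Record.entry_congr_of_restrict_eq h hr (hζl.trans_le hlγ)]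

/-! ### A state with prescribed facts -/

open Classical in
/-- The place below the limit ordinal `l` where a `1` gives the `l`-parity prescribed by `g`. -/
noncomputable def parityPlace (G : Finset Ordinal.{u}) (g : Ordinal.{u} → Prop)
    (l : Ordinal.{u}) : Ordinal.{u} :=
  if OrdEven ((G.filter (· < l)).sup id + 1) ↔ g l then (G.filter (· < l)).sup id
  else (G.filter (· < l)).sup id + 1

theorem ordEven_parityPlace (G : Finset Ordinal.{u}) (g : Ordinal.{u} → Prop)
    (l : Ordinal.{u}) : OrdEven (parityPlace G g l + 1) ↔ g l := by
  unfold parityPlace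
  split_ifs with h
  · exact h
  · rw [ordEven_add_one]
    tauto

theorem le_parityPlace {G : Finset Ordinal.{u}} {g : Ordinal.{u} → Prop} {l ξ : Ordinal.{u}}
    (hξ : ξ ∈ G) (h : ξ < l) : ξ ≤ parityPlace G g l := by
  classical
  have : ξ ≤ (G.filter (· < l)).sup id :=
    Finset.le_sup (f := id) (Finset.mem_filter.2 ⟨hξ, h⟩)
  unfold parityPlace
  split_ifs
  · exact this
  · exact this.trans le_self_add

theorem parityPlace_lt {G : Finset Ordinal.{u}} {g : Ordinal.{u} → Prop} {l : Ordinal.{u}}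
    (hl : Order.IsSuccLimit l) : parityPlace G g l < l := by
  classical
  have : (G.filter (· < l)).sup id < l := by
    rw [Finset.sup_lt_iff hl.bot_lt]
    exact fun ξ hξ => (Finset.mem_filter.1 hξ).2
  unfold parityPlace
  split_ifs
  · exact this
  · exact isSuccLimit_add_one_lt hl this

theorem parityPlace_congr {G G' : Finset Ordinal.{u}} {g g' : Ordinal.{u} → Prop}
    {l : Ordinal.{u}} (hG : ∀ ξ < l, ξ ∈ G ↔ ξ ∈ G') (hg : g l ↔ g' l) :
    parityPlace G g l = parityPlace G' g' l := by
  classical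
  have : G.filter (· < l) = G'.filter (· < l) := by
    ext ξ
    simp only [Finset.mem_filter]
    exact and_congr_left (hG ξ)
  unfold parityPlace
  simp only [this, hg]

/-- The support of a record for which the facts with indices in `G` are as prescribed by `g`. -/
def fillSupport (G : Finset Ordinal.{u}) (g : Ordinal.{u} → Prop) : Set Ordinal.{u} :=
  {ξ | ξ + 1 ∈ G ∧ g (ξ + 1)} ∪ {ξ | ∃ l ∈ G, Order.IsSuccLimit l ∧ ξ = parityPlace G g l}

theorem finite_fillSupport (G : Finset Ordinal.{u}) (g : Ordinal.{u} → Prop) :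
    (fillSupport G g).Finite := by
  refine Set.Finite.union ?_ ?_
  · refine Set.Finite.of_finite_image (f := fun ξ => ξ + 1) (G.finite_toSet.subset ?_) ?_
    · rintro _ ⟨ξ, hξ, rfl⟩
      exact hξ.1
    · intro a _ b _ h
      simpa using h
  · refine (G.finite_toSet.image (parityPlace G g)).subset ?_
    rintro ξ ⟨l, hl, _, rfl⟩
    exact ⟨l, hl, rfl⟩

theorem mem_fillSupport_of_add_one_mem {G : Finset Ordinal.{u}} {g : Ordinal.{u} → Prop}
    {ξ : Ordinal.{u}} (h : ξ + 1 ∈ G) : ξ ∈ fillSupport G g ↔ g (ξ + 1) := by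
  constructor
  · rintro (h1 | ⟨l, hl, hlim, h1⟩)
    · exact h1.2
    · have h2 : ξ < l := h1 ▸ parityPlace_lt hlim
      have h3 := le_parityPlace (g := g) h (isSuccLimit_add_one_lt hlim h2)
      rw [← h1] at h3
      exact absurd ((lt_add_one ξ).trans_le h3) (lt_irrefl _)
  · exact fun h1 => Or.inl ⟨h, h1⟩

theorem notMem_fillSupport {G : Finset Ordinal.{u}} {g : Ordinal.{u} → Prop}
    {ξ l : Ordinal.{u}} (hlim : Order.IsSuccLimit l) (hlG : l ∈ G)
    (h : parityPlace G g l < ξ) (hξ : ξ < l) : ξ ∉ fillSupport G g := by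
  rintro (h1 | ⟨l', hl', hlim', h1⟩)
  · have := le_parityPlace (g := g) h1.1 (isSuccLimit_add_one_lt hlim hξ)
    exact absurd ((lt_add_one ξ).trans_le (this.trans h.le)) (lt_irrefl _)
  · rcases lt_trichotomy l l' with h2 | rfl | h2
    · have := le_parityPlace (g := g) hlG h2
      exact absurd (hξ.trans_le (h1 ▸ this)) (lt_irrefl _)
    · exact h.ne' h1
    · have := le_parityPlace (g := g) hl' h2
      have h3 : ξ < l' := h1 ▸ parityPlace_lt hlim'
      exact absurd (h3.trans_le (this.trans h.le)) (lt_irrefl _)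

theorem fillSupport_congr {G G' : Finset Ordinal.{u}} {g g' : Ordinal.{u} → Prop}
    {β : Ordinal.{u}} (hG : ∀ ξ ≤ β, ξ ∈ G ↔ ξ ∈ G') (hg : ∀ ξ ≤ β, g ξ ↔ g' ξ) (hβ : β ∈ G)
    {ξ : Ordinal.{u}} (hξ : ξ < β) (h : ξ ∈ fillSupport G g) : ξ ∈ fillSupport G' g' := by
  rcases h with h | ⟨l, hl, hlim, h⟩
  · have h1 : ξ + 1 ≤ β := Order.add_one_le_iff.2 hξ
    exact Or.inl ⟨(hG _ h1).1 h.1, (hg _ h1).1 h.2⟩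
  · have hlβ : l ≤ β := by
      by_contra! h1
      exact absurd (hξ.trans_le (h ▸ le_parityPlace hβ h1)) (lt_irrefl _)
    refine Or.inr ⟨l, (hG _ hlβ).1 hl, hlim, h.trans ?_⟩
    exact parityPlace_congr (fun ξ h1 => hG ξ (h1.le.trans hlβ)) (hg l hlβ)

open Classical in
/-- A state with record `r` for player `i` in which the facts about nature and the other player with
indices in `G` are as prescribed by `g`. -/
noncomputable def World.fill {α : Ordinal.{u}} (i : Player) (r : Record α) (G : Finset Ordinal.{u})
    (g : Ordinal.{u} → Prop) : World α where
  nat := if g 0 then Coin.h else Coin.t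
  rcd k := if k = i then r else Record.ofFinite α (fillSupport G g) (finite_fillSupport G g)

theorem Player.other_ne (i : Player) : i.other ≠ i := by
  cases i <;> simp [Player.other]

section fill

variable {α : Ordinal.{u}} {i : Player} {r : Record α} {G : Finset Ordinal.{u}}
  {g : Ordinal.{u} → Prop}

theorem World.fill_rcd : (World.fill i r G g).rcd i = r := by
  simp [World.fill]

theorem World.fill_rcd_other : (World.fill i r G g).rcd i.other =
    Record.ofFinite α (fillSupport G g) (finite_fillSupport G g) := by
  simp [World.fill, Player.other_ne]

theorem World.datum_fill {ξ : Ordinal.{u}} (hξ : ξ < α) (hG : ξ ∈ G) :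
    (World.fill i r G g).datum i ξ ↔ g ξ := by
  revert hξ hG
  refine ordinal_cases ξ ?_ ?_ ?_
  · intro _ _
    rw [World.datum_zero]
    by_cases h : g 0 <;> simp [World.fill, h]
  · intro β hβ hG
    rw [World.datum_add_one ((lt_add_one β).trans hβ), World.fill_rcd_other, Record.entry_ofFinite,
      mem_fillSupport_of_add_one_mem hG]
  · intro l hl hlim hG
    have hp : parityPlace G g l < l := parityPlace_lt hl
    rw [World.datum_limit hl, World.fill_rcd_other, Record.ParEven,
      Record.lastZero_eq_add_one hl (hp.trans hlim) hp, ordEven_parityPlace]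
    · rw [Record.entry_ofFinite]
      exact Or.inr ⟨l, hG, hl, rfl⟩
    · intro β hβ h1 h2
      rw [← Bool.not_eq_true, Record.entry_ofFinite]
      exact notMem_fillSupport hl hG h1 h2

end fill

/-! ### Existence of the beliefs -/

theorem FinAddProb.prob_compl {M : Type*} (P : FinAddProb M) (E : Set M) :
    P.prob Eᶜ = 1 - P.prob E := by
  have := P.add_of_disjoint E Eᶜ disjoint_compl_right
  rw [Set.union_compl_self, P.prob_univ] at this
  linarith

open Classical in
/-- The two-valued measure given by an ultrafilter. -/
noncomputable def ultraProb {M : Type*} (U : Ultrafilter M) : FinAddProb M where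
  prob E := if E ∈ U then 1 else 0
  nonneg E := by split_ifs <;> norm_num
  add_of_disjoint E F h := by
    have hEF : ¬ (E ∈ U ∧ F ∈ U) := fun ⟨h1, h2⟩ => by
      have h3 := Filter.inter_mem h1 h2
      rw [h.inter_eq] at h3
      exact U.empty_notMem h3
    by_cases h1 : E ∈ U <;> by_cases h2 : F ∈ U <;>
      simp_all [Ultrafilter.union_mem_iff]
  prob_univ := if_pos Filter.univ_mem

theorem prob_ultraProb_map {M N : Type*} (U : Ultrafilter N) (f : N → M) (E : Set M)
    [Decidable (f ⁻¹' E ∈ U)] :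
    (ultraProb (U.map f)).prob E = if f ⁻¹' E ∈ U then 1 else 0 := by
  classical
  exact if_congr Ultrafilter.mem_map rfl rfl

/-- The average of two measures. -/
noncomputable def FinAddProb.average {M : Type*} (P Q : FinAddProb M) : FinAddProb M where
  prob E := (P.prob E + Q.prob E) / 2
  nonneg E := by
    have := P.nonneg E
    have := Q.nonneg E
    positivity
  add_of_disjoint E F h := by
    rw [P.add_of_disjoint E F h, Q.add_of_disjoint E F h]
    ring
  prob_univ := by
    rw [P.prob_univ, Q.prob_univ]
    norm_num

/-- An ultrafilter on the finite sets of ordinals that contains all sets `{F | ξ ∈ F}`. -/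
noncomputable def finsetUltrafilter : Ultrafilter (Finset Ordinal.{u}) :=
  Ultrafilter.of Filter.atTop

theorem mem_finsetUltrafilter (ξ : Ordinal.{u}) : {F | ξ ∈ F} ∈ finsetUltrafilter.{u} := by
  classical
  refine Ultrafilter.of_le Filter.atTop ?_
  filter_upwards [Filter.eventually_ge_atTop {ξ}] with F hF
  exact hF (Finset.mem_singleton_self ξ)

section beliefs

variable {α : Ordinal.{u}}

/-- The facts known to player `i` in the state `x`, and the value `b` for all others. -/
def World.known (i : Player) (x : World α) (b : Prop) (ξ : Ordinal.{u}) : Prop :=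
  (ξ ∈ (x.rcd i).support ∧ x.datum i ξ) ∨ (ξ ∉ (x.rcd i).support ∧ b)

open Classical in
/-- A state that agrees with the facts known to player `i` in the state `x`, and in which the other
facts with indices in `F` have the value `b`. -/
noncomputable def World.approx (i : Player) (x : World α) (b : Prop) (F : Finset Ordinal.{u}) :
    World α :=
  World.fill i (x.rcd i) ((x.rcd i).finite_support.toFinset ∪ F) (x.known i b)

theorem World.datum_approx_of_mem {i : Player} {x : World α} {b : Prop} {F : Finset Ordinal.{u}}
    {ξ : Ordinal.{u}} (hξ : ξ ∈ (x.rcd i).support) :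
    (x.approx i b F).datum i ξ ↔ x.datum i ξ := by
  rw [World.approx, World.datum_fill hξ.1 (by simp [hξ])]
  simp [World.known, hξ]

theorem World.datum_approx_of_notMem {i : Player} {x : World α} {b : Prop}
    {F : Finset Ordinal.{u}} {ξ : Ordinal.{u}} (h : ξ < α) (hξ : ξ ∉ (x.rcd i).support)
    (hF : ξ ∈ F) : (x.approx i b F).datum i ξ ↔ b := by
  rw [World.approx, World.datum_fill h (by simp [hF])]
  simp [World.known, hξ]

theorem World.approx_mem_cell {i : Player} {x : World α} {b : Prop} {F : Finset Ordinal.{u}} :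
    x.approx i b F ∈ World.cell i x := by
  rw [World.mem_cell_iff]
  exact ⟨World.fill_rcd, fun ξ hξ => World.datum_approx_of_mem hξ⟩

theorem World.approx_congr {i : Player} {x y : World α} (h : y ∈ World.cell i x) (b : Prop) :
    y.approx i b = x.approx i b := by
  rw [World.mem_cell_iff] at h
  obtain ⟨h1, h2⟩ := h
  have : y.known i b = x.known i b := by
    ext ξ
    simp only [World.known, h1]
    exact or_congr (and_congr_right fun h => h2 ξ h) Iff.rfl
  funext F
  simp only [World.approx, h1, this]

theorem World.mem_support_congr {β γ ξ : Ordinal.{u}} (hβ : β < γ) (hγ : γ ≤ α) {i : Player}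
    {x y : World α} (h : x.restrict γ hγ = y.restrict γ hγ) (hξ : ξ ≤ β) :
    ξ ∈ (x.rcd i).support ↔ ξ ∈ (y.rcd i).support := by
  have hr : (x.rcd i).restrict γ hγ = (y.rcd i).restrict γ hγ :=
    congrFun (congrArg World.rcd h) i
  have hξγ := hξ.trans_lt hβ
  refine exists_congr fun h => ?_
  rw [Record.entry_congr_of_restrict_eq hγ hr hξγ]

theorem World.known_congr {β γ ξ : Ordinal.{u}} (hβ : β < γ) (hγ : γ ≤ α) {i : Player}
    {x y : World α} (h : x.restrict γ hγ = y.restrict γ hγ) (b : Prop) (hξ : ξ ≤ β) :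
    x.known i b ξ ↔ y.known i b ξ := by
  unfold World.known
  rw [World.mem_support_congr hβ hγ h hξ, World.datum_congr hγ h (hξ.trans hβ.le)]

theorem World.restrict_approx_congr {β γ : Ordinal.{u}} (hβ : β < γ) (hγ : γ ≤ α) {i : Player}
    {x y : World α} (h : x.restrict γ hγ = y.restrict γ hγ) (b : Prop) {F : Finset Ordinal.{u}}
    (hF : β ∈ F) : (x.approx i b F).restrict β (hβ.le.trans hγ) =
      (y.approx i b F).restrict β (hβ.le.trans hγ) := by
  classical
  have hk := fun ξ => World.known_congr (ξ := ξ) (i := i) hβ hγ h b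
  ext k
  · change (x.approx i b F).nat = (y.approx i b F).nat
    exact if_congr (hk 0 zero_le) rfl rfl
  · rename_i ξ
    revert ξ
    rw [← funext_iff, ← Record.ext_iff]
    have hβα : β ≤ α := hβ.le.trans hγ
    change ((x.approx i b F).rcd k).restrict β hβα = ((y.approx i b F).rcd k).restrict β hβα
    by_cases hki : k = i
    · subst hki
      simp only [World.approx, World.fill_rcd]
      ext ξ
      exact congrFun (congrArg Record.val (congrFun (congrArg World.rcd h) k))
        ⟨ξ.1, lt_trans ξ.2 hβ⟩
    · simp only [World.approx, World.fill, if_neg hki]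
      have hG : ∀ ξ ≤ β, ξ ∈ (x.rcd i).finite_support.toFinset ∪ F ↔
          ξ ∈ (y.rcd i).finite_support.toFinset ∪ F := by
        intro ξ hξ
        simp [World.mem_support_congr hβ hγ h hξ]
      refine Record.restrict_ofFinite_congr _ fun ξ hξ => ⟨?_, ?_⟩
      · exact fillSupport_congr hG hk (by simp [hF]) hξ
      · exact fillSupport_congr (fun ξ h => (hG ξ h).symm) (fun ξ h => (hk ξ h).symm)
          (by simp [hF]) hξ

/-- The beliefs of player `i` in the state `x`: with equal probabilities, all the facts that he does
not know are true or all of them are false. -/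
noncomputable def World.beliefs (i : Player) (x : World α) : FinAddProb (World α) :=
  (ultraProb (finsetUltrafilter.map (x.approx i True))).average
    (ultraProb (finsetUltrafilter.map (x.approx i False)))

theorem World.prob_beliefs_eq_one {i : Player} {x : World α} {E : Set (World α)}
    (h : ∀ b F, x.approx i b F ∈ E) : (x.beliefs i).prob E = 1 := by
  classical
  have (b : Prop) : (x.approx i b) ⁻¹' E = Set.univ := Set.eq_univ_of_forall (h b)
  have hU : Set.univ ∈ finsetUltrafilter.{u} := Filter.univ_mem
  simp [World.beliefs, FinAddProb.average, prob_ultraProb_map, this, hU]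

theorem World.prob_beliefs_congr {i : Player} {x y : World α} {E : Set (World α)}
    {A : Set (Finset Ordinal.{u})} (hA : A ∈ finsetUltrafilter.{u})
    (h : ∀ b, ∀ F ∈ A, x.approx i b F ∈ E ↔ y.approx i b F ∈ E) :
    (x.beliefs i).prob E = (y.beliefs i).prob E := by
  classical
  have (b : Prop) : (x.approx i b) ⁻¹' E ∈ finsetUltrafilter.{u} ↔
      (y.approx i b) ⁻¹' E ∈ finsetUltrafilter.{u} := by
    constructor <;> intro hE <;> filter_upwards [hE, hA] with F h1 h2
    · exact (h b F h2).1 h1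
    · exact (h b F h2).2 h1
  simp [World.beliefs, FinAddProb.average, prob_ultraProb_map, this]

theorem World.prob_beliefs_datum {i : Player} {x : World α} {ξ : Ordinal.{u}} (h : ξ < α) :
    (x.beliefs i).prob {y | y.datum i ξ ↔ x.datum i ξ} =
      if (x.rcd i).entry ξ h = true then 1 else 1 / 2 := by
  classical
  split_ifs with h1
  · exact World.prob_beliefs_eq_one fun b F => World.datum_approx_of_mem ⟨h, h1⟩
  · have hξ : ξ ∉ (x.rcd i).support := fun ⟨_, h2⟩ => h1 h2
    have key (b : Prop) : (x.approx i b) ⁻¹' {y | y.datum i ξ ↔ x.datum i ξ} ∈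
        finsetUltrafilter.{u} ↔ (b ↔ x.datum i ξ) := by
      have hF := mem_finsetUltrafilter ξ
      constructor
      · intro hE
        obtain ⟨F, hF1, hF2⟩ := finsetUltrafilter.nonempty_of_mem (Filter.inter_mem hE hF)
        exact (World.datum_approx_of_notMem h hξ hF2).symm.trans hF1
      · intro hb
        filter_upwards [hF] with F hF2
        exact (World.datum_approx_of_notMem h hξ hF2).trans hb
    simp only [World.beliefs, FinAddProb.average, prob_ultraProb_map, key]
    by_cases h2 : x.datum i ξ <;> simp [h2]

end beliefs

theorem isSoberDrunk_beliefs (κ : Cardinal.{u}) :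
    IsSoberDrunk κ fun i x => World.beliefs i x where
  eq_of_mem_cell i x y h := by
    simp only [World.beliefs, World.approx_congr h]
  prob_cell i x := World.prob_beliefs_eq_one fun _ _ => World.approx_mem_cell
  prob_nat i x h := by
    simpa only [World.nat_eq_iff (i := i)] using World.prob_beliefs_datum h
  prob_entry i x β hβ h := by
    simpa only [World.entry_eq_iff] using World.prob_beliefs_datum h
  prob_parity i x l h hl := by
    simpa only [World.parEven_iff hl] using World.prob_beliefs_datum h
  prob_level i x y α β hα hβ h E := by
    refine World.prob_beliefs_congr (mem_finsetUltrafilter β) fun b F hF => ?_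
    rw [Set.mem_ofPred_eq, Set.mem_ofPred_eq, World.restrict_approx_congr hβ hα.le h b hF]

theorem IsSoberDrunk.prob_datum {κ : Cardinal.{u}}
    {T : Player → World κ.ord → FinAddProb (World κ.ord)} (hT : IsSoberDrunk κ T) (i : Player)
    (x : World κ.ord) {ξ : Ordinal.{u}} (h : ξ < κ.ord) :
    (T i x).prob {y | y.datum i ξ ↔ x.datum i ξ} =
      if (x.rcd i).entry ξ h = true then 1 else 1 / 2 := by
  revert h
  refine ordinal_cases ξ ?_ ?_ ?_
  · intro h
    simpa only [World.nat_eq_iff (i := i)] using hT.prob_nat i x h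
  · intro β h
    have := hT.prob_entry i x β ((lt_add_one β).trans h) h
    simpa only [World.entry_eq_iff] using this
  · intro l hl h
    simpa only [World.parEven_iff hl] using hT.prob_parity i x l h hl

end Belief
namespace Belief

/-! ### Type spaces that represent the beliefs of the two players -/

/-- In the type space `X` the players `p a` and `p b` have the beliefs given by `T`, the states of
nature `f h` and `f t` are distinct, and the beliefs of all other players are constant. -/
structure Represents {κ : Cardinal.{u}} {I : Type v} {S : Type w} {M : Type*}
    (T : Player → World κ.ord → FinAddProb (World κ.ord)) (X : StarTypeSpace I S M)
    (e : M ≃ World κ.ord) (p : Player → I) (f : Coin → S) : Prop where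
  prob_preimage : ∀ k m E, (X.T (p k) m).prob (e ⁻¹' E) = (T k (e m)).prob E
  const : ∀ i ∉ Set.range p, ∀ m m', X.T i m = X.T i m'
  nature : ∀ m, X.θ m = f (e m).nat
  injective : Function.Injective f

theorem represents_soberDrunkSpace {κ : Cardinal.{u}}
    {T : Player → World κ.ord → FinAddProb (World κ.ord)} (hT : IsSoberDrunk κ T) :
    Represents T (soberDrunkSpace T hT) (Equiv.refl _) id id where
  prob_preimage _ _ _ := rfl
  const i hi := absurd ⟨i, rfl⟩ hi
  nature _ := rfl
  injective := Function.injective_id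

section

variable {κ : Cardinal.{u}} {I : Type v} {S : Type w} {M : Type*}
  {T : Player → World κ.ord → FinAddProb (World κ.ord)} {X : StarTypeSpace I S M}
  {e : M ≃ World κ.ord} {p : Player → I} {f : Coin → S}

/-- The truth of an expression of depth at most `α` depends only on the entries below `α`. -/
theorem Represents.mem_event_congr (hX : Represents T X e p f) (hT : IsSoberDrunk κ T)
    {κ' : Cardinal.{u}} (φ : KExpr κ' I S) :
    ∀ (α : Ordinal.{u}) (hα : α < κ.ord), φ.depth ≤ α → ∀ x y : M,
      (e x).restrict α hα.le = (e y).restrict α hα.le → (x ∈ X.event φ ↔ y ∈ X.event φ) := by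
  induction φ with
  | nature E =>
    intro α hα _ x y h
    have hn : ((e x).restrict α hα.le).nat = ((e y).restrict α hα.le).nat := congrArg World.nat h
    change X.θ x ∈ E ↔ X.θ y ∈ E
    rw [hX.nature, hX.nature, show (e x).nat = (e y).nat from hn]
  | neg φ ih =>
    intro α hα hφ x y h
    exact not_congr (ih α hα hφ x y h)
  | belief i q φ ih =>
    intro α hα hφ x y h
    have hβ : φ.depth < α := Order.add_one_le_iff.1 hφ
    change (q : ℝ) ≤ (X.T i x).prob (X.event φ) ↔ (q : ℝ) ≤ (X.T i y).prob (X.event φ)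
    by_cases hi : i ∈ Set.range p
    · obtain ⟨k, rfl⟩ := hi
      have hE : X.event φ = e ⁻¹' {z | z.restrict φ.depth (hβ.trans hα).le ∈
          {w | ∃ m ∈ X.event φ, (e m).restrict φ.depth (hβ.trans hα).le = w}} := by
        ext m
        refine ⟨fun hm => ⟨m, hm, rfl⟩, ?_⟩
        rintro ⟨m', hm', hmm'⟩
        exact (ih _ (hβ.trans hα) le_rfl m' m hmm').1 hm'
      rw [hE, hX.prob_preimage, hX.prob_preimage,
        hT.prob_level k (e x) (e y) α φ.depth hα hβ h]
    · rw [hX.const i hi x y]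
  | conj ι hne hcard φ ih =>
    intro α hα hφ x y h
    have hk : ∀ k, (φ k).depth ≤ α := fun k =>
      (Ordinal.le_iSup (fun k => (φ k).depth) k).trans hφ
    change x ∈ ⋂ k, X.event (φ k) ↔ y ∈ ⋂ k, X.event (φ k)
    rw [Set.mem_iInter, Set.mem_iInter]
    exact forall_congr' fun k => ih k α hα (hk k) x y h

/-! ### Definable events -/

/-- The event `E` is described by a `κ`-expression of depth at most `γ`. -/
def StarTypeSpace.Definable (X : StarTypeSpace I S M) (κ : Cardinal.{u}) (γ : Ordinal.{u})
    (E : Set M) : Prop :=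
  ∃ φ : KExpr κ I S, φ.depth ≤ γ ∧ X.event φ = E

namespace StarTypeSpace.Definable

variable {γ δ : Ordinal.{u}} {E F : Set M}

theorem mono (hE : X.Definable κ γ E) (h : γ ≤ δ) : X.Definable κ δ E := by
  obtain ⟨φ, hφ, rfl⟩ := hE
  exact ⟨φ, hφ.trans h, rfl⟩

theorem nature (D : Set S) : X.Definable κ γ (X.θ ⁻¹' D) :=
  ⟨.nature D, zero_le, rfl⟩

theorem univ : X.Definable κ γ Set.univ :=
  nature Set.univ

theorem compl (hE : X.Definable κ γ E) : X.Definable κ γ Eᶜ := by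
  obtain ⟨φ, hφ, rfl⟩ := hE
  exact ⟨.neg φ, hφ, rfl⟩

theorem believes_one (i : I) (hE : X.Definable κ γ E) :
    X.Definable κ (γ + 1) (X.believes i 1 E) := by
  obtain ⟨φ, hφ, rfl⟩ := hE
  exact ⟨.belief i 1 φ, by simpa [KExpr.depth] using hφ, rfl⟩

theorem iInter {ι : Type u} (hι : #ι < κ) {E : ι → Set M} (hE : ∀ k, X.Definable κ γ (E k)) :
    X.Definable κ γ (⋂ k, E k) := by
  choose φ hφ hE using hE
  rcases isEmpty_or_nonempty ι with h | h
  · rw [Set.iInter_of_empty]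
    exact univ
  · exact ⟨.conj ι h hι φ, Ordinal.iSup_le hφ, Set.iInter_congr hE⟩

theorem forall_lt {l : Ordinal.{u}} (hl : l < κ.ord) {E : Ordinal.{u} → Set M}
    (hE : ∀ β < l, X.Definable κ γ (E β)) : X.Definable κ γ {m | ∀ β < l, m ∈ E β} := by
  have h : {m | ∀ β < l, m ∈ E β} = ⋂ k : l.ToType, E k.toOrd := by
    ext m
    rw [Set.mem_iInter]
    refine ⟨fun h k => h _ k.toOrd.2, fun h β hβ => ?_⟩
    simpa using h (Ordinal.ToType.mk ⟨β, hβ⟩)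
  rw [h]
  exact iInter (by rwa [Cardinal.mk_toType, ← Cardinal.lt_ord]) fun k => hE _ k.toOrd.2

theorem exists_lt {l : Ordinal.{u}} (hl : l < κ.ord) {E : Ordinal.{u} → Set M}
    (hE : ∀ β < l, X.Definable κ γ (E β)) : X.Definable κ γ {m | ∃ β < l, m ∈ E β} := by
  have h := (forall_lt hl fun β hβ => (hE β hβ).compl).compl
  convert h using 1
  ext m
  simp

theorem imp (c : Prop) (hE : c → X.Definable κ γ E) : X.Definable κ γ {m | c → m ∈ E} := by
  by_cases h : c
  · simpa [h] using hE h
  · simpa [h] using univ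

theorem inter (hκ : ℵ₀ ≤ κ) (hE : X.Definable κ γ E) (hF : X.Definable κ γ F) :
    X.Definable κ γ (E ∩ F) := by
  have h := iInter (X := X) (κ := κ) (γ := γ) (ι := ULift.{u} Bool)
    (E := fun k => if k.down then E else F)
    ((Cardinal.lt_aleph0_of_finite _).trans_le hκ) (fun k => by split_ifs <;> assumption)
  convert h using 1
  ext m
  simp [ULift.forall]
  tauto

theorem union (hκ : ℵ₀ ≤ κ) (hE : X.Definable κ γ E) (hF : X.Definable κ γ F) :
    X.Definable κ γ (E ∪ F) := by
  have h := (inter hκ hE.compl hF.compl).compl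
  rwa [Set.compl_inter, compl_compl, compl_compl] at h

end StarTypeSpace.Definable

theorem Record.parEven_iff {α : Ordinal.{u}} (r : Record α) {l : Ordinal.{u}}
    (hl : Order.IsSuccLimit l) (hlα : l ≤ α) :
    r.ParEven l ↔ ∃ γ < l, OrdEven γ ∧ (∀ β < l, γ ≤ β → β ∉ r.support) ∧
      ∀ γ' < γ, ¬ ∀ β < l, γ' ≤ β → β ∉ r.support := by
  have hZ : {γ | γ < l ∧ ∀ β : Set.Iio α, γ ≤ β.1 → β.1 < l → r.val β = false} =
      {γ | γ < l ∧ ∀ β < l, γ ≤ β → β ∉ r.support} := by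
    ext γ
    refine and_congr_right fun _ => ⟨fun h β h1 h2 h3 => ?_, fun h β h1 h2 => ?_⟩
    · have := h ⟨β, h1.trans_le hlα⟩ h2 h1
      obtain ⟨h3, h4⟩ := h3
      rw [Record.entry] at h4
      simp [this] at h4
    · by_contra h3
      exact h β.1 h2 h1 ⟨β.2, (Bool.not_eq_false _).mp h3⟩
  have hne : {γ | γ < l ∧ ∀ β < l, γ ≤ β → β ∉ r.support}.Nonempty := by
    rw [← hZ]
    exact r.eventually_zero l hl hlα
  rw [Record.ParEven, Record.lastZero, hZ]
  constructor
  · intro h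
    obtain ⟨h1, h2⟩ := csInf_mem hne
    refine ⟨_, h1, h, h2, fun γ' hγ' h3 => ?_⟩
    exact notMem_of_lt_csInf' hγ' ⟨hγ'.trans h1, h3⟩
  · rintro ⟨γ, h1, h2, h3, h4⟩
    suffices sInf {γ | γ < l ∧ ∀ β < l, γ ≤ β → β ∉ r.support} = γ by rwa [this]
    refine le_antisymm (csInf_le' ⟨h1, h3⟩) (le_csInf hne ?_)
    rintro γ' ⟨_, h5⟩
    by_contra! h6
    exact h4 γ' h6 h5

theorem Represents.definable_datum (hX : Represents T X e p f) (hκ : ℵ₀ ≤ κ) {ξ : Ordinal.{u}}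
    (hξ : ξ < κ.ord)
    (ih : ∀ β < ξ, ∀ k, X.Definable κ (β + 1) {m | β ∈ ((e m).rcd k).support}) (k : Player) :
    X.Definable κ ξ {m | (e m).datum k ξ} := by
  revert hξ ih
  refine ordinal_cases ξ ?_ ?_ ?_
  · intro _ _
    convert StarTypeSpace.Definable.nature (X := X) (f '' {Coin.h}) using 1
    ext m
    simp only [Set.mem_ofPred_eq, Set.mem_preimage, World.datum_zero, hX.nature]
    rw [hX.injective.mem_set_image, Set.mem_singleton_iff]
  · intro β hβ ih
    have hβ' := (lt_add_one β).trans hβ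
    convert ih β (lt_add_one β) k.other using 1
    ext m
    simp only [Set.mem_ofPred_eq, World.datum_add_one hβ']
    exact ⟨fun h => ⟨hβ', h⟩, fun ⟨_, h⟩ => h⟩
  · intro l hl hlκ ih
    have hZ (γ : Ordinal.{u}) : X.Definable κ l
        {m | ∀ β < l, m ∈ {m | γ ≤ β → m ∈ {m | β ∈ ((e m).rcd k.other).support}ᶜ}} :=
      .forall_lt hlκ fun β hβ => .imp _ fun _ =>
        ((ih β hβ k.other).mono (Order.add_one_le_iff.2 hβ)).compl
    have key := StarTypeSpace.Definable.exists_lt (X := X) hlκ fun γ hγ =>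
      StarTypeSpace.Definable.inter hκ
        (.imp (¬ OrdEven γ) fun _ => StarTypeSpace.Definable.univ.compl)
        (.inter hκ (hZ γ) (.forall_lt (hγ.trans hlκ) fun γ' _ => (hZ γ').compl))
    convert key using 1
    ext m
    simp only [Set.mem_ofPred_eq, World.datum_limit hl, Record.parEven_iff _ hl hlκ.le]
    refine exists_congr fun γ => and_congr_right fun _ => ?_
    simp only [Set.mem_inter_iff, Set.mem_compl_iff, Set.mem_ofPred_eq, Set.mem_univ]
    tauto

theorem Represents.mem_support_iff (hX : Represents T X e p f) (hT : IsSoberDrunk κ T)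
    {ξ : Ordinal.{u}} (hξ : ξ < κ.ord) (k : Player) (m : M) :
    ξ ∈ ((e m).rcd k).support ↔ m ∈ X.believes (p k) 1 {m | (e m).datum k ξ} ∪
      X.believes (p k) 1 {m | (e m).datum k ξ}ᶜ := by
  classical
  have h := hT.prob_datum k (e m) hξ
  change _ ↔ 1 ≤ (X.T (p k) m).prob (e ⁻¹' {z | z.datum k ξ}) ∨
    1 ≤ (X.T (p k) m).prob (e ⁻¹' {z | z.datum k ξ}ᶜ)
  rw [hX.prob_preimage, hX.prob_preimage, FinAddProb.prob_compl]
  have h1 : ξ ∈ ((e m).rcd k).support ↔ ((e m).rcd k).entry ξ hξ = true :=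
    ⟨fun ⟨_, h⟩ => h, fun h => ⟨hξ, h⟩⟩
  have h2 : (T k (e m)).prob {z | z.datum k ξ} =
      if (e m).datum k ξ then (T k (e m)).prob {y | y.datum k ξ ↔ (e m).datum k ξ}
      else 1 - (T k (e m)).prob {y | y.datum k ξ ↔ (e m).datum k ξ} := by
    split_ifs with hd
    · simp [hd]
    · rw [← FinAddProb.prob_compl]
      congr 1
      ext z
      simp [hd]
  rw [h1, h2, h]
  by_cases h3 : ((e m).rcd k).entry ξ hξ = true <;> by_cases h4 : (e m).datum k ξ <;>
    simp only [h3, h4, if_true, if_false] <;> norm_num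

theorem Represents.definable_support (hX : Represents T X e p f) (hT : IsSoberDrunk κ T)
    (hκ : ℵ₀ ≤ κ) (ξ : Ordinal.{u}) (hξ : ξ < κ.ord) (k : Player) :
    X.Definable κ (ξ + 1) {m | ξ ∈ ((e m).rcd k).support} := by
  induction ξ using WellFoundedLT.induction generalizing k with
  | ind ξ ih =>
    have hd := hX.definable_datum hκ hξ (fun β hβ k => ih β hβ (hβ.trans hξ) k) k
    rw [show {m | ξ ∈ ((e m).rcd k).support} = _ from Set.ext (hX.mem_support_iff hT hξ k)]
    exact .union hκ (hd.believes_one _) (hd.compl.believes_one _)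

/-- The state in which both records have the support `s`. -/
noncomputable def World.ofFinite (α : Ordinal.{u}) (s : Set Ordinal.{u}) (hs : s.Finite) :
    World α where
  nat := Coin.h
  rcd _ := Record.ofFinite α s hs

/-- For every `α < κ` there are two states with the same entries below `α` that are separated by an
expression of depth `α + 1`. -/
theorem Represents.exists_separated (hX : Represents T X e p f) (hT : IsSoberDrunk κ T)
    (hκ : ℵ₀ ≤ κ) (α : Ordinal.{u}) (hα : α < κ.ord) :
    ∃ x y : M, (e x).restrict α hα.le = (e y).restrict α hα.le ∧
      ∃ ψ : KExpr κ I S, ψ.depth = α + 1 ∧ x ∈ X.event ψ ∧ y ∈ X.event ψ.neg := by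
  obtain ⟨ψ, hψ, hE⟩ := hX.definable_support hT hκ α hα Player.a
  have hxy : (World.ofFinite κ.ord {α} (Set.finite_singleton α)).restrict α hα.le =
      (World.ofFinite κ.ord ∅ Set.finite_empty).restrict α hα.le := by
    refine World.ext rfl (funext fun k => ?_)
    exact Record.restrict_ofFinite_congr (hs := Set.finite_singleton α) (ht := Set.finite_empty)
      hα.le fun ξ hξ => by simp [hξ.ne]
  have hx : e.symm (World.ofFinite κ.ord {α} (Set.finite_singleton α)) ∈ X.event ψ := by
    rw [hE, Set.mem_ofPred_eq, Equiv.apply_symm_apply]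
    exact ⟨hα, (Record.entry_ofFinite (hs := Set.finite_singleton α) hα).2 rfl⟩
  have hy : e.symm (World.ofFinite κ.ord ∅ Set.finite_empty) ∉ X.event ψ := by
    rw [hE, Set.mem_ofPred_eq, Equiv.apply_symm_apply]
    rintro ⟨_, h⟩
    exact (Record.entry_ofFinite (hs := Set.finite_empty) hα).1 h
  have hr : (e (e.symm (World.ofFinite κ.ord {α} (Set.finite_singleton α)))).restrict α hα.le =
      (e (e.symm (World.ofFinite κ.ord ∅ Set.finite_empty))).restrict α hα.le := by
    simpa using hxy
  refine ⟨_, _, hr, ψ, hψ.antisymm (Order.add_one_le_iff.2 ?_), hx, hy⟩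
  by_contra! h
  exact hy ((hX.mem_event_congr hT ψ α hα h _ _ hr).1 hx)

end

/-! ### Arbitrary sets of players and of states of nature -/

theorem FinAddProb.prob_eq_one_of_subset {M : Type*} (P : FinAddProb M) {E F : Set M} (h : E ⊆ F)
    (hE : P.prob E = 1) : P.prob F = 1 := by
  have h1 := P.add_of_disjoint E (F \ E) Set.disjoint_sdiff_right
  rw [Set.union_sdiff_cancel h] at h1
  have h2 := P.prob_compl F
  linarith [P.nonneg (F \ E), P.nonneg Fᶜ]

/-- The image of a measure. -/
def FinAddProb.map {M N : Type*} (g : M → N) (P : FinAddProb M) : FinAddProb N where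
  prob E := P.prob (g ⁻¹' E)
  nonneg _ := P.nonneg _
  add_of_disjoint _ _ h := P.add_of_disjoint _ _ (h.preimage g)
  prob_univ := P.prob_univ

open Classical in
/-- The beliefs of the players `p a` and `p b` are those given by `T`; all other players have the
same beliefs in all states. -/
noncomputable def transferBeliefs {W : Type*} {I : Type v} {M : Type*}
    (T : Player → W → FinAddProb W) (e : M ≃ W) (x₀ : W) (p : Player → I) (i : I) (m : M) : FinAddProb M :=
  if h : ∃ k, p k = i then (T h.choose (e m)).map e.symm else (T Player.a x₀).map e.symm

theorem exists_represents {κ : Cardinal.{u}}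
    {T : Player → World κ.ord → FinAddProb (World κ.ord)} (hT : IsSoberDrunk κ T)
    {I : Type v} {S : Type w} {M : Type*} (e : M ≃ World κ.ord) {p : Player → I}
    (hp : Function.Injective p) {f : Coin → S} (hf : Function.Injective f) :
    ∃ X : StarTypeSpace I S M, Represents T X e p f := by
  have x₀ : World κ.ord := World.ofFinite _ ∅ Set.finite_empty
  have hTp (k : Player) (m : M) :
      transferBeliefs T e x₀ p (p k) m = (T k (e m)).map e.symm := by
    have h : ∃ k', p k' = p k := ⟨k, rfl⟩
    rw [transferBeliefs, dif_pos h, hp h.choose_spec]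
  have hTc (i : I) (hi : i ∉ Set.range p) (m : M) :
      transferBeliefs T e x₀ p i m = (T Player.a x₀).map e.symm := dif_neg hi
  refine ⟨⟨⟨e.symm x₀⟩, transferBeliefs T e x₀ p, fun i m => ?_, fun m => f (e m).nat⟩,
    ⟨fun k m E => ?_, fun i hi m m' => ?_, fun m => rfl, hf⟩⟩
  · by_cases hi : i ∈ Set.range p
    · obtain ⟨k, rfl⟩ := hi
      simp only [hTp]
      refine FinAddProb.prob_eq_one_of_subset (T k (e m)) (F := e.symm ⁻¹'
        {m' | (T k (e m')).map e.symm = (T k (e m)).map e.symm}) ?_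
        ((soberDrunkSpace T hT).introspection k (e m))
      intro z hz
      have hz' : T k z = T k (e m) := hz
      simp [hz']
    · simp only [hTc i hi]
      simpa using FinAddProb.prob_univ _
  · simp only [hTp, FinAddProb.map]
    rw [← Set.preimage_comp, Equiv.self_comp_symm, Set.preimage_id]
  · simp only [hTc i hi]

theorem KExpr.depth_lt {μ κ : Cardinal.{u}} (hμ : μ.IsRegular) (hκ : κ ≤ μ) {I : Type v}
    {S : Type w} (φ : KExpr κ I S) : φ.depth < μ.ord := by
  have hlim := Cardinal.isSuccLimit_ord hμ.aleph0_le
  induction φ with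
  | nature E => exact hlim.bot_lt
  | neg φ ih => exact ih
  | belief i q φ ih => exact isSuccLimit_add_one_lt hlim ih
  | conj ι hne hcard φ ih =>
    refine Ordinal.iSup_lt_of_lt_cof ?_ ih
    rw [hμ.cof_ord]
    exact hcard.trans_le hκ

instance small_record (α : Ordinal.{u}) : Small.{u} (Record α) :=
  small_of_injective (f := Record.val) fun _ _ h => Record.ext h

instance small_world (α : Ordinal.{u}) : Small.{u} (World α) :=
  small_of_injective (f := fun x : World α => (x.nat, x.rcd)) fun _ _ h =>
    World.ext (congrArg Prod.fst h) (congrArg Prod.snd h)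

end Belief

theorem theorem3 :
    (∀ κ : Cardinal.{u}, κ.IsRegular →
      (∃ T : Player → World κ.ord → FinAddProb (World κ.ord), IsSoberDrunk κ T) ∧
      ∀ (T : Player → World κ.ord → FinAddProb (World κ.ord)) (hT : IsSoberDrunk κ T),
        ∀ α < κ.ord, ∃ x y : World κ.ord,
          (∀ φ : KExpr κ Player Coin, φ.depth ≤ α →
            (x ∈ (soberDrunkSpace T hT).event φ ↔ y ∈ (soberDrunkSpace T hT).event φ)) ∧
          ∃ ψ : KExpr κ Player Coin, ψ.depth = α + 1 ∧
            x ∈ (soberDrunkSpace T hT).event ψ ∧ y ∈ (soberDrunkSpace T hT).event ψ.neg) ∧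
    (∀ (I : Type v) (S : Type w) [Nontrivial I] [Nontrivial S],
      ¬ ∃ κ₀ : Cardinal.{u}, ∀ κ : Cardinal.{u}, κ.IsRegular → κ₀ < κ →
        ∀ (M : Type u) (X : StarTypeSpace I S M) (x y : M),
          X.description κ₀ x = X.description κ₀ y →
            X.description κ x = X.description κ y) := by
  refine ⟨fun κ hκ => ⟨⟨_, isSoberDrunk_beliefs κ⟩, fun T hT α hα => ?_⟩, ?_⟩
  · have hX := represents_soberDrunkSpace hT
    obtain ⟨x, y, hxy, hψ⟩ := hX.exists_separated hT hκ.aleph0_le α hα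
    exact ⟨x, y, fun φ hφ => hX.mem_event_congr hT φ α hα hφ x y hxy, hψ⟩
  · rintro I S _ _ ⟨κ₀, H⟩
    obtain ⟨i, j, hij⟩ := exists_pair_ne I
    obtain ⟨s, t, hst⟩ := exists_pair_ne S
    have hμ : (Order.succ (max κ₀ ℵ₀)).IsRegular := Cardinal.isRegular_succ (le_max_right _ _)
    have hκ₀ : κ₀ ≤ Order.succ (max κ₀ ℵ₀) := (le_max_left _ _).trans (Order.le_succ _)
    generalize Order.succ (max κ₀ ℵ₀) = μ at hμ hκ₀
    have hκ := Cardinal.isRegular_succ hμ.aleph0_le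
    have hμκ : μ < Order.succ μ := Order.lt_succ μ
    generalize Order.succ μ = κ at hκ hμκ
    have hα : μ.ord < κ.ord := Cardinal.ord_lt_ord.2 hμκ
    have hT := isSoberDrunk_beliefs κ
    obtain ⟨X, hX⟩ := exists_represents hT (equivShrink.{u} (World κ.ord)).symm
      (p := fun k => match k with | .a => i | .b => j)
      (by rintro (_ | _) (_ | _) h <;> first | rfl | exact absurd h hij | exact absurd h hij.symm)
      (f := fun c => match c with | .h => s | .t => t)
      (by rintro (_ | _) (_ | _) h <;> first | rfl | exact absurd h hst | exact absurd h hst.symm)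
    obtain ⟨x, y, hxy, ψ, -, hx, hy⟩ := hX.exists_separated hT hκ.aleph0_le _ hα
    have hdesc := H κ hκ (hκ₀.trans_lt hμκ) _ X x y (Set.ext fun φ =>
      hX.mem_event_congr hT φ _ hα (φ.depth_lt hμ hκ₀).le x y hxy)
    exact hy (show ψ ∈ X.description κ y from hdesc ▸ hx)
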